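/- All algebras are associative complex algebras, not necessarily unital. A *-algebra is a complex algebra $A$ with a conjugate-linear map $a\mapsto a^*$ satisfying $(a^*)^*=a$ and $(ab)^*=b^*a^*$; an element $a$ is selfadjoint if $a^*=a$, and a projection is an element $e$ with $e=e^*=e^2$. $A$ is algebraic if each of its elements generates a finite dimensional subalgebra. The spectrum of $a\in A$ is $\{\lambda\in\mathbb{C} : \lambda\mathbf{1}-a \text{ has no inverse in } A\}$ if $A$ has a unit $\mathbf{1}$, and the spectrum of $(0,a)$ in the unitization $\mathbb{C}\oplus A$ if $A$ has no unit; $A$ is hermitian if every selfadjoint element has real spectrum. $A$ is semisimple if its Jacobson radical (the intersection of all maximal modular left ideals of $A$, understood as $A$ itself if there are none) is $\{0\}$. A pre-$C^*$-norm on $A$ is a (not necessarily complete) submultiplicative norm $\sigma$ on $A$ with $\sigma(a^*a)=\sigma(a)^2$ for all $a\in A$. Theorem. Let $A$ be an algebraic *-algebra. The following assertions are equivalent: (i) there exists a pre-$C^*$-norm on $A$; (ii) the involution of $A$ is proper, that is, for every $a\in A$, $a^*a=0$ implies $a=0$; (iii) $A$ is hermitian and semisimple; (iv) every non-zero selfadjoint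 $b\in A$ can be written as a finite sum $b=\sum_{j\in J}\lambda_je_j$, where $(\lambda_j)_{j\in J}$ is a finite system of non-zero distinct real numbers and $(e_j)_{j\in J}$ is a finite system of non-zero, pairwise orthogonal projections in $A$ (that is, $e_ie_j=0$ for $i\neq j$); (v) $A$ is a weakly Rickart *-ring, that is, for every $a\in A$ there is a projection $e\in A$ such that $ae=a$ and, for every $y\in A$, $ay=0$ implies $ey=0$; (vi) $A$ is hermitian and von Neumann regular, that is, $A$ is hermitian and for every $a\in A$ there is an $x\in A$ with $axa=a$. -/

import Mathlib

namespace AlgStar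

section Ring

variable (A : Type*) [NonUnitalRing A]

/-- A (not necessarily unital) ring is von Neumann regular if every `a` has some `x` with
`a x a = a`. -/
def IsVonNeumannRegular : Prop :=
  ∀ a : A, ∃ x : A, a * x * a = a

/-- `u` is a (two-sided) unit element of the ring `A`. -/
def IsUnitElement {A : Type*} [NonUnitalRing A] (u : A) : Prop :=
  ∀ x : A, u * x = x ∧ x * u = x

/-- The involution of the *-ring `A` is proper. -/
def IsProperInvolution [StarRing A] : Prop :=
  ∀ a : A, star a * a = 0 → a = 0

/-- Weakly Rickart *-rings: for every `a` there is a projection `e` with `a e = a` such that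
`a y = 0` implies `e y = 0`. -/
def IsWeaklyRickart [StarRing A] : Prop :=
  ∀ a : A, ∃ e : A, IsStarProjection e ∧ a * e = a ∧ ∀ y : A, a * y = 0 → e * y = 0

end Ring

section Algebra

variable (A : Type*) [NonUnitalRing A] [Module ℂ A] [IsScalarTower ℂ A A] [SMulCommClass ℂ A A]

/-- An algebra is algebraic if every element generates a finite dimensional subalgebra
(without adjoining a unit). -/
def IsAlgebraicAlgebra : Prop :=
  ∀ a : A, FiniteDimensional ℂ (NonUnitalAlgebra.adjoin ℂ ({a} : Set A))

variable {A} in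
/-- The spectrum of `a` in `A`. If `A` has a unit element `u` it is the set of `z` such that
`z u - a` has no inverse in `A` (the unit element is unique, so it does not matter that `u` is
quantified); if `A` has no unit element, it is the spectrum of `(0, a)` in the unitization
`ℂ ⊕ A`. -/
def Sp (a : A) : Set ℂ :=
  {z | (∀ u : A, IsUnitElement u → ¬ ∃ x : A, (z • u - a) * x = u ∧ x * (z • u - a) = u) ∧
    ((¬ ∃ u : A, IsUnitElement u) → z ∈ spectrum ℂ (a : Unitization ℂ A))}

/-- Every selfadjoint element has real spectrum. -/
def IsHermitianAlgebra [StarRing A] : Prop :=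
  ∀ a : A, IsSelfAdjoint a → ∀ z ∈ Sp a, z.im = 0

variable {A} in
/-- Left ideals of the algebra `A`. -/
def IsLeftIdeal (L : Submodule ℂ A) : Prop :=
  ∀ x : A, ∀ y ∈ L, x * y ∈ L

variable {A} in
/-- `L` is a maximal modular left ideal: a proper left ideal, modular (there is a `u` with
`x - x u ∈ L` for all `x`), and maximal among the proper left ideals. -/
structure IsMaximalModularLeftIdeal (L : Submodule ℂ A) : Prop where
  isLeftIdeal : IsLeftIdeal L
  modular : ∃ u : A, ∀ x : A, x - x * u ∈ L
  ne_top : L ≠ ⊤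
  eq_top_of_lt : ∀ M : Submodule ℂ A, IsLeftIdeal M → L < M → M = ⊤

/-- The Jacobson radical of a (not necessarily unital) algebra: the intersection of its maximal
modular left ideals (the whole algebra if there are none). -/
def jacobsonRadical : Submodule ℂ A :=
  sInf {L : Submodule ℂ A | IsMaximalModularLeftIdeal L}

/-- Semisimple in the sense of Jacobson: the Jacobson radical is zero. -/
def IsJacobsonSemisimple : Prop :=
  jacobsonRadical A = ⊥

/-- There is a pre-C*-norm on `A`: a (possibly incomplete) submultiplicative norm `σ` with
`σ (a* a) = σ (a) ^ 2`. -/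
def HasPreCStarNorm [StarRing A] : Prop :=
  ∃ σ : Seminorm ℂ A,
    (∀ a b : A, σ (a * b) ≤ σ a * σ b) ∧
    (∀ a : A, σ (star a * a) = σ a ^ 2) ∧
    (∀ a : A, σ a = 0 → a = 0)

/-- Every non-zero selfadjoint `b` is a finite sum `∑ cⱼ eⱼ` with distinct non-zero real
coefficients `cⱼ` and non-zero, pairwise orthogonal projections `eⱼ`. -/
def HasFiniteSpectralDecompositions [StarRing A] : Prop :=
  ∀ b : A, IsSelfAdjoint b → b ≠ 0 →
    ∃ (n : ℕ) (c : Fin n → ℝ) (e : Fin n → A),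
      (∀ j, c j ≠ 0) ∧ Function.Injective c ∧
      (∀ j, IsStarProjection (e j) ∧ e j ≠ 0) ∧
      (∀ i j, i ≠ j → e i * e j = 0) ∧
      b = ∑ j, (c j : ℂ) • e j

end Algebra

end AlgStar

/-! Everything passes through properness (ii). Algebraicity makes the unitization integral over `ℂ`,
and properness extends to it. If `b` is selfadjoint, each root of its minimal polynomial has an
eigenvector `x ≠ 0`; since `x* x ≠ 0`, the roots are real and simple, and Lagrange interpolation
yields spectral projections. This gives (iv) and hermiticity, and, applied to `a* a`, the support
projections behind (v) and (vi).

The hard implication is (ii) → (i): the elements `z* z` must form a cone. The core is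
`star_mul_self_ne_neg_smul`: a corner of `y* y` is never a negative multiple of a non-zero
projection. After shrinking the projection, `y` itself compresses to a scalar, and properness then
forces `y g = -a g` for two different scalars `a`. In the resulting order the norm of `a` is the
least `s ≥ 0` with `a* a ≤ s²`.

Conversely, (iv) gives (ii) because `h² + k² = 0` forces `k = 0` for selfadjoint `h`, `k`.
Regularity gives semisimplicity, since non-zero idempotents avoid the radical. In a hermitian
algebra `a* a = 0` puts `a` in the radical, by factoring `1 + (y* - y)` with `y = a c`. -/

namespace AlgStar

/-! ### Minimal polynomials and spectral projections in the unital case -/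

section Unital

variable {B : Type*} [Ring B] [Algebra ℂ B]

/-- A root of the minimal polynomial is an eigenvalue, with an eigenvector in `ℂ[w]`. -/
lemma exists_aeval_ne_zero_of_isRoot [Algebra.IsIntegral ℂ B] (w : B) {z : ℂ}
    (hz : (minpoly ℂ w).IsRoot z) :
    ∃ q : Polynomial ℂ, minpoly ℂ w = (Polynomial.X - Polynomial.C z) * q ∧
      Polynomial.aeval w q ≠ 0 := by
  obtain ⟨q, hq⟩ := Polynomial.dvd_iff_isRoot.mpr hz
  have hw : IsIntegral ℂ w := Algebra.IsIntegral.isIntegral w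
  have h0 := minpoly.ne_zero hw
  refine ⟨q, hq, fun h => ?_⟩
  have hq0 : q ≠ 0 := by rintro rfl; simp at hq; exact h0 hq
  have hle := minpoly.degree_le_of_ne_zero ℂ w hq0 h
  rw [hq, Polynomial.degree_mul, Polynomial.degree_X_sub_C, Polynomial.degree_eq_natDegree hq0] at hle
  norm_cast at hle
  lia

/-- The constant term `c` of the minimal polynomial decides: if `c = 0`, the cofactor of `X`
annihilates `w`; otherwise `X q + c` gives the inverse `-q(w) / c`. -/
lemma isUnit_or_exists_ne_zero [Algebra.IsIntegral ℂ B] (w : B) :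
    IsUnit w ∨ ∃ x : B, x ≠ 0 ∧ x * w = 0 ∧ w * x = 0 := by
  by_cases hz : (minpoly ℂ w).IsRoot 0
  · obtain ⟨q, hq, hq0⟩ := exists_aeval_ne_zero_of_isRoot w hz
    right
    have h := minpoly.aeval ℂ w
    refine ⟨_, hq0, ?_, ?_⟩
    · rw [hq, mul_comm] at h; simpa using h
    · rw [hq] at h; simpa using h
  · left
    obtain ⟨q, hq⟩ : Polynomial.X ∣
        minpoly ℂ w - Polynomial.C ((minpoly ℂ w).coeff 0) := Polynomial.X_dvd_sub_C
    set c := (minpoly ℂ w).coeff 0 with hc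
    have hc0 : c ≠ 0 := by rwa [Polynomial.IsRoot.def, ← Polynomial.coeff_zero_eq_eval_zero] at hz
    have h1 : w * Polynomial.aeval w q = -(algebraMap ℂ B c) := by
      have := congrArg (Polynomial.aeval w) hq
      simpa using this.symm
    have h2 : Polynomial.aeval w q * w = -(algebraMap ℂ B c) := by
      have := congrArg (Polynomial.aeval w) (hq.trans (mul_comm _ _))
      simpa using this.symm
    have h3 : algebraMap ℂ B c * algebraMap ℂ B c⁻¹ = 1 := by
      rw [← map_mul, mul_inv_cancel₀ hc0, map_one]
    have h4 : algebraMap ℂ B c⁻¹ * algebraMap ℂ B c = 1 := by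
      rw [← map_mul, inv_mul_cancel₀ hc0, map_one]
    rw [isUnit_iff_exists_and_exists]
    exact ⟨⟨-(Polynomial.aeval w q * algebraMap ℂ B c⁻¹), by
        rw [mul_neg, ← mul_assoc, h1, neg_mul, neg_neg, h3]⟩,
      ⟨-(algebraMap ℂ B c⁻¹ * Polynomial.aeval w q), by
        rw [neg_mul, mul_assoc, h2, mul_neg, neg_neg, h4]⟩⟩

lemma isUnit_of_mul_eq_one_of_isIntegral [Algebra.IsIntegral ℂ B] {c w : B} (h : c * w = 1) :
    IsUnit w := by
  rcases isUnit_or_exists_ne_zero w with hw | ⟨x, hx, -, hwx⟩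
  · exact hw
  · exact absurd (by rw [← one_mul x, ← h, mul_assoc, hwx, mul_zero]) hx

variable [StarRing B] [StarModule ℂ B]

/-- Evaluating `x* b x` in two ways gives `(z - z̄) x* x = 0`. -/
lemma eigenvalue_im_eq_zero (hp : IsProperInvolution B) {b x : B} (hb : IsSelfAdjoint b)
    (hx : x ≠ 0) {z : ℂ} (h : b * x = z • x) : z.im = 0 := by
  have h1 : star x * b = star z • star x := by
    have := congrArg star h
    rwa [star_mul, star_smul, hb.star_eq] at this
  have h2 : (z - star z) • (star x * x) = 0 := by
    rw [sub_smul, ← mul_smul_comm, ← h, ← smul_mul_assoc, ← h1, mul_assoc, sub_self]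
  rcases smul_eq_zero.mp h2 with h3 | h3
  · exact Complex.conj_eq_iff_im.mp (sub_eq_zero.mp h3).symm
  · exact absurd (hp x h3) hx

/-- The minimal polynomial of a selfadjoint element has only simple roots. -/
lemma nodup_roots_minpoly [Algebra.IsIntegral ℂ B] (hp : IsProperInvolution B) {b : B}
    (hb : IsSelfAdjoint b) : (minpoly ℂ b).roots.Nodup := by
  have h0 := minpoly.ne_zero (Algebra.IsIntegral.isIntegral (R := ℂ) b)
  rw [Multiset.nodup_iff_count_le_one]
  intro z
  rw [Polynomial.count_roots]
  by_contra! hlt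
  obtain ⟨r, hr⟩ := (Polynomial.le_rootMultiplicity_iff h0).mp (Nat.succ_le_of_lt hlt)
  have hz : (minpoly ℂ b).IsRoot z := by rw [hr]; simp
  obtain ⟨q, hq, hq0⟩ := exists_aeval_ne_zero_of_isRoot b hz
  have hqr : q = (Polynomial.X - Polynomial.C z) * r := by
    apply mul_left_cancel₀ (Polynomial.X_sub_C_ne_zero z)
    rw [← hq, ← mul_assoc, ← sq]; exact hr
  set x := Polynomial.aeval b q with hx
  have h1 : (b - algebraMap ℂ B z) * x = 0 := by
    have := minpoly.aeval ℂ b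
    rw [hq] at this; simpa using this
  have hzr : b * x = z • x := by
    rw [sub_mul, sub_eq_zero] at h1; rw [h1, Algebra.smul_def]
  have him := eigenvalue_im_eq_zero hp hb hq0 hzr
  -- As `z` is real, `b - z` is selfadjoint, so a double root gives `x* x = r(b)* (b - z) x = 0`.
  have hx' : x = (b - algebraMap ℂ B z) * Polynomial.aeval b r := by rw [hx, hqr]; simp
  have hstar : star (b - algebraMap ℂ B z) = b - algebraMap ℂ B z := by
    rw [star_sub, hb.star_eq, ← algebraMap_star_comm, Complex.star_def,
      Complex.conj_eq_iff_im.mpr him]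
  apply hq0
  apply hp
  conv_lhs => rw [hx']
  rw [star_mul, hstar, mul_assoc, ← hx', h1, mul_zero]

/-- Spectral decomposition of a selfadjoint element. -/
theorem exists_spectral_decomposition [Algebra.IsIntegral ℂ B] (hp : IsProperInvolution B)
    {b : B} (hb : IsSelfAdjoint b) :
    ∃ (S : Finset ℝ) (e : ℝ → B),
      (∀ r ∈ S, IsStarProjection (e r) ∧ e r ≠ 0 ∧ b * e r = (r : ℂ) • e r) ∧
      (∀ r ∈ S, ∀ s ∈ S, r ≠ s → e r * e s = 0) ∧ ∑ r ∈ S, e r = 1 := by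
  classical
  set p := minpoly ℂ b with hpdef
  have hmonic : p.Monic := minpoly.monic (Algebra.IsIntegral.isIntegral (R := ℂ) b)
  set T := p.roots.toFinset with hT
  have hprod : p = ∏ z ∈ T, (Polynomial.X - Polynomial.C z) := by
    conv_lhs => rw [(IsAlgClosed.splits p).eq_prod_roots, hmonic.leadingCoeff, map_one, one_mul]
    rw [hT, Finset.prod_multiset_map_count]
    refine Finset.prod_congr rfl fun z hz => ?_
    rw [Multiset.count_eq_one_of_mem (nodup_roots_minpoly hp hb) (by simpa using hz), pow_one]
  have him : ∀ z ∈ T, z.im = 0 := by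
    intro z hz
    have hz : p.IsRoot z := Polynomial.isRoot_of_mem_roots (by simpa [hT] using hz)
    obtain ⟨q, hq, hq0⟩ := exists_aeval_ne_zero_of_isRoot b hz
    have h1 := minpoly.aeval ℂ b
    rw [hq] at h1
    refine eigenvalue_im_eq_zero hp hb hq0 ?_
    simpa [sub_mul, sub_eq_zero, Algebra.smul_def] using h1
  by_cases hB : Subsingleton B
  · exact ⟨∅, 0, by simp, by simp, Subsingleton.elim _ _⟩
  rw [not_subsingleton_iff_nontrivial] at hB
  have hTne : T.Nonempty := by
    rw [Finset.nonempty_iff_ne_empty]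
    rintro h
    rw [h, Finset.prod_empty] at hprod
    have := minpoly.aeval ℂ b
    rw [← hpdef, hprod] at this
    simp at this
  -- As the roots are simple, the Lagrange basis polynomials at `b` are the spectral idempotents; as
  -- they are real, `ℝ` can index them.
  let f : ℝ → B := fun r => Polynomial.aeval b (Lagrange.basis T id (r : ℂ))
  let S : Finset ℝ := T.image Complex.re
  have hTS : ∀ g : ℂ → B, ∑ r ∈ S, g (r : ℂ) = ∑ z ∈ T, g z := by
    intro g
    rw [Finset.sum_image]
    · refine Finset.sum_congr rfl fun z hz => ?_
      congr 1; apply Complex.ext <;> simp [him z hz]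
    · intro z hz w hw h
      exact Complex.ext h (by rw [him z hz, him w hw])
  have hST : ∀ r ∈ S, (r : ℂ) ∈ T := by
    intro r hr
    obtain ⟨z, hz, rfl⟩ := Finset.mem_image.mp hr
    convert hz
    apply Complex.ext <;> simp [him z hz]
  have hsum : ∑ r ∈ S, f r = 1 := by
    rw [hTS (fun z => Polynomial.aeval b (Lagrange.basis T id z)), ← map_sum,
      Lagrange.sum_basis (Set.injOn_id _) hTne, map_one]
  have hbf : ∀ r ∈ S, b * f r = (r : ℂ) • f r := by
    intro r hr
    have hdvd : p ∣ (Polynomial.X - Polynomial.C (r : ℂ)) * Lagrange.basis T id (r : ℂ) := by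
      rw [Lagrange.basis_eq_prod_sub_inv_mul_nodal_div (hST r hr),
        ← Lagrange.nodal_erase_eq_nodal_div (hST r hr), mul_left_comm]
      have := Lagrange.nodal_eq_mul_nodal_erase (v := (id : ℂ → ℂ)) (hST r hr)
      rw [id_eq] at this
      rw [← this, hprod, Lagrange.nodal_eq]
      exact Dvd.intro_left _ rfl
    obtain ⟨q, hq⟩ := hdvd
    have h1 := congrArg (Polynomial.aeval b) hq
    rw [map_mul, map_mul _ p q, hpdef, minpoly.aeval, zero_mul] at h1
    simpa [sub_mul, sub_eq_zero, Algebra.smul_def] using h1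
  have hfb : ∀ r ∈ S, star (f r) * b = (r : ℂ) • star (f r) := by
    intro r hr
    have := congrArg star (hbf r hr)
    rwa [star_mul, star_smul, hb.star_eq, Complex.star_def, Complex.conj_ofReal] at this
  have horth : ∀ r ∈ S, ∀ s ∈ S, r ≠ s → star (f r) * f s = 0 := by
    intro r hr s hs hrs
    have h : ((r : ℂ) - s) • (star (f r) * f s) = 0 := by
      rw [sub_smul, ← smul_mul_assoc, ← hfb r hr, ← mul_smul_comm, ← hbf s hs, mul_assoc, sub_self]
    refine (smul_eq_zero.mp h).resolve_left ?_
    rw [sub_eq_zero]; exact_mod_cast hrs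
  -- Multiplying `1 = ∑ f s` by `(f r)*` leaves `(f r)* = (f r)* f r`, hence both selfadjointness
  -- and idempotence.
  have hself : ∀ r ∈ S, star (f r) = star (f r) * f r := by
    intro r hr
    conv_lhs => rw [← mul_one (star (f r)), ← hsum, Finset.mul_sum]
    exact Finset.sum_eq_single_of_mem r hr fun s hs hne => horth r hr s hs hne.symm
  have hsa : ∀ r ∈ S, star (f r) = f r := by
    intro r hr
    have := congrArg star (hself r hr)
    rw [star_mul, star_star, ← hself r hr] at this
    exact this.symm
  refine ⟨S.filter fun r => f r ≠ 0, f, ?_, ?_, ?_⟩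
  · intro r hr
    rw [Finset.mem_filter] at hr
    refine ⟨⟨?_, hsa r hr.1⟩, hr.2, hbf r hr.1⟩
    have := hself r hr.1
    rw [hsa r hr.1] at this
    exact this.symm
  · intro r hr s hs hrs
    rw [Finset.mem_filter] at hr hs
    have := horth r hr.1 s hs.1 hrs
    rwa [hsa r hr.1] at this
  · rw [Finset.sum_filter_ne_zero, hsum]

end Unital

end AlgStar

namespace AlgStar

/-! ### Compressions to projections and the cone of squares -/

section Unital

variable {B : Type*} [Ring B] [Algebra ℂ B] [StarRing B] [StarModule ℂ B]

/-- A compression to a non-zero projection `e` has an eigenvector; its range projection is a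
projection `g ≤ e` compressing the element to a scalar. -/
theorem exists_projection_compression_scalar [Algebra.IsIntegral ℂ B] (hp : IsProperInvolution B)
    {e : B} (he : IsStarProjection e) (he0 : e ≠ 0) (z : B) :
    ∃ (g : B) (c : ℂ), IsStarProjection g ∧ g ≠ 0 ∧ e * g = g ∧ g * e = g ∧ g * z * g = c • g := by
  classical
  have hee : e * e = e := he.isIdempotentElem
  set w := e * z * e with hw
  have hwe : w * e = w := by rw [hw, mul_assoc, hee]
  have hew : e * w = w := by rw [hw, ← mul_assoc, ← mul_assoc, hee]
  have hcomm : ∀ q : Polynomial ℂ, e * Polynomial.aeval w q = Polynomial.aeval w q * e := by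
    intro q
    induction q using Polynomial.induction_on' with
    | add p q h1 h2 => rw [map_add, mul_add, add_mul, h1, h2]
    | monomial n a =>
      have : Commute e w := by rw [Commute, SemiconjBy, hwe, hew]
      rw [Polynomial.aeval_monomial]
      have h1 : Commute e (algebraMap ℂ B a) := (Algebra.commutes a e).symm
      exact h1.mul_right (this.pow_right n)
  obtain ⟨c, x, hx0, hex, hwx⟩ : ∃ (c : ℂ) (x : B), x ≠ 0 ∧ e * x = x ∧ w * x = c • x := by
    -- A polynomial of least degree with `p(w) e = 0` acts as the minimal polynomial of `w` in the
    -- corner with unit `e`, so the eigenvector it produces lies under `e`.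
    have hex : ∃ n, ∃ p : Polynomial ℂ, p ≠ 0 ∧ Polynomial.aeval w p * e = 0 ∧ p.natDegree = n :=
      ⟨_, minpoly ℂ w, minpoly.ne_zero (Algebra.IsIntegral.isIntegral w),
        by rw [minpoly.aeval, zero_mul], rfl⟩
    obtain ⟨p, hp0, hpe, hpn⟩ := Nat.find_spec hex
    have hdeg : p.degree ≠ 0 := by
      intro hd
      rw [Polynomial.eq_C_of_degree_eq_zero hd, Polynomial.aeval_C, ← Algebra.smul_def] at hpe
      rw [Polynomial.eq_C_of_degree_eq_zero hd, Polynomial.C_ne_zero] at hp0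
      exact (smul_eq_zero.mp hpe).elim hp0 he0
    obtain ⟨c, hc⟩ := IsAlgClosed.exists_root p hdeg
    obtain ⟨q, rfl⟩ := Polynomial.dvd_iff_isRoot.mpr hc
    have hq0 : q ≠ 0 := right_ne_zero_of_mul hp0
    refine ⟨c, Polynomial.aeval w q * e, fun h => ?_, ?_, ?_⟩
    · refine Nat.find_min hex (m := q.natDegree) ?_ ⟨q, hq0, h, rfl⟩
      rw [← hpn, Polynomial.natDegree_mul (Polynomial.X_sub_C_ne_zero c) hq0,
        Polynomial.natDegree_X_sub_C]
      lia
    · rw [← mul_assoc, hcomm, mul_assoc, hee]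
    · simpa [sub_mul, sub_eq_zero, mul_assoc, Algebra.smul_def] using hpe
  have hh : IsSelfAdjoint (x * star x) := .mul_star_self x
  have hh0 : x * star x ≠ 0 := by
    intro h
    exact hx0 (star_eq_zero.mp (hp (star x) (by rwa [star_star])))
  obtain ⟨S, f, hf, -, hsum⟩ := exists_spectral_decomposition hp hh
  obtain ⟨r, hr, hne⟩ : ∃ r ∈ S, x * star x * f r ≠ 0 := by
    by_contra! hcon
    apply hh0
    rw [← mul_one (x * star x), ← hsum, Finset.mul_sum]
    exact Finset.sum_eq_zero hcon
  obtain ⟨hfp, hf0, hfr⟩ := hf r hr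
  have hr0 : (r : ℂ) ≠ 0 := by
    intro h; rw [hfr, h, zero_smul] at hne; exact hne rfl
  -- As `r ≠ 0`, the projection `f r` lies in `x B` and inherits from `x` the relations `e x = x`
  -- and `w x = c x`.
  have hfx : f r = x * ((r : ℂ)⁻¹ • (star x * f r)) := by
    rw [mul_smul_comm, ← mul_assoc, hfr, inv_smul_smul₀ hr0]
  have hef : e * f r = f r := by
    conv_lhs => rw [hfx, ← mul_assoc, hex]
    exact hfx.symm
  have hfe : f r * e = f r := by
    have := congrArg star hef
    rwa [star_mul, he.isSelfAdjoint.star_eq, hfp.isSelfAdjoint.star_eq] at this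
  have hwf : w * f r = c • f r := by
    conv_lhs => rw [hfx, ← mul_assoc, hwx, smul_mul_assoc]
    rw [← hfx]
  refine ⟨f r, c, hfp, hf0, hef, hfe, ?_⟩
  calc f r * z * f r = (f r * e) * z * (e * f r) := by rw [hef, hfe]
    _ = f r * (w * f r) := by rw [hw]; simp only [mul_assoc]
    _ = c • f r := by rw [hwf, mul_smul_comm, hfp.isIdempotentElem.eq]

/-- The equation says `|a + c|² = 1 + |c|²`, a circle of positive radius about `-c`; two opposite
points are taken. -/
lemma exists_norm_sq_eq (c : ℂ) :
    ∃ a b : ℂ, a ≠ b ∧ star a * a + star a * c + a * star c = 1 ∧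
      star b * b + star b * c + b * star c = 1 := by
  set t : ℝ := √(1 + Complex.normSq c) with ht
  have hpos : 0 < 1 + Complex.normSq c := by have := Complex.normSq_nonneg c; linarith
  have htt : (t : ℂ) * t = 1 + star c * c := by
    rw [← Complex.ofReal_mul, ht, Real.mul_self_sqrt hpos.le, Complex.ofReal_add,
      Complex.ofReal_one, Complex.normSq_eq_conj_mul_self]; rfl
  have ht0 : (t : ℂ) ≠ 0 := by exact_mod_cast (Real.sqrt_pos.mpr hpos).ne'
  refine ⟨t - c, -t - c, ?_, ?_, ?_⟩
  · intro h
    apply ht0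
    linear_combination h / 2
  all_goals
    simp only [star_sub, star_neg, Complex.star_def, Complex.conj_ofReal] at htt ⊢
    linear_combination htt

/-- No corner of `star y * y` is a negative multiple of a non-zero projection. -/
theorem star_mul_self_ne_neg_smul [Algebra.IsIntegral ℂ B] (hp : IsProperInvolution B)
    {e : B} (he : IsStarProjection e) (he0 : e ≠ 0) (y : B) {r : ℝ} (hr : r < 0) :
    e * (star y * y) * e ≠ (r : ℂ) • e := by
  intro hy
  set s : ℝ := (√(-r))⁻¹ with hs
  have hss : s * s * r = -1 := by
    rw [hs, ← mul_inv, Real.mul_self_sqrt (by linarith), inv_neg, neg_mul, inv_mul_cancel₀ hr.ne]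
  set v := (s : ℂ) • y with hv
  have hvv : e * (star v * v) * e = -e := by
    rw [hv, star_smul, smul_mul_smul_comm, mul_smul_comm, smul_mul_assoc, hy, smul_smul,
      Complex.star_def, Complex.conj_ofReal, ← Complex.ofReal_mul, ← Complex.ofReal_mul, hss]
    simp
  clear_value v
  obtain ⟨g, c, hg, hg0, heg, hge, hgv⟩ := exists_projection_compression_scalar hp he he0 v
  have hgg : g * g = g := hg.isIdempotentElem
  have hgs : star g = g := hg.isSelfAdjoint
  have hgsv : g * star v * g = star c • g := by
    have := congrArg star hgv
    rwa [star_mul, star_mul, star_smul, hgs, ← mul_assoc] at this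
  have hgvv : g * (star v * v) * g = -g := by
    calc g * (star v * v) * g = (g * e) * (star v * v) * (e * g) := by rw [heg, hge]
      _ = g * (e * (star v * v) * e) * g := by simp only [mul_assoc]
      _ = -g := by rw [hvv, mul_neg, hge, neg_mul, hgg]
  -- Expanding, `(v g + a g)* (v g + a g)` is `(|a|² + ā c + a c̄ - 1) g`, which vanishes for these
  -- `a`.
  have key : ∀ a : ℂ, star a * a + star a * c + a * star c = 1 → v * g = -(a • g) := by
    intro a ha
    rw [← add_eq_zero_iff_eq_neg]
    apply hp
    have : star (v * g + a • g) * (v * g + a • g) = g * (star v * v) * g +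
        a • (g * star v * g * g) + star a • (g * (g * v * g)) +
        (star a * a) • (g * g * (g * g)) := by
      simp only [star_add, star_mul, star_smul, hgs, add_mul, mul_add, smul_mul_assoc,
        mul_smul_comm]
      simp only [hgg, mul_assoc]
      simp only [← mul_assoc, hgg]
      rw [smul_add, smul_smul, mul_comm a (star a)]
      abel
    rw [this, hgvv, hgsv, hgv, mul_smul_comm, smul_mul_assoc, hgg, hgg, smul_smul, smul_smul,
      neg_add_eq_sub, sub_add_eq_add_sub, sub_add_eq_add_sub, ← add_smul, ← add_smul, sub_eq_zero]
    conv_rhs => rw [← one_smul ℂ g, ← ha]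
    congr 1
    ring
  obtain ⟨a, b, hab, ha, hb⟩ := exists_norm_sq_eq c
  have h1 := (key a ha).symm.trans (key b hb)
  rw [neg_inj, ← sub_eq_zero, ← sub_smul] at h1
  exact (smul_eq_zero.mp h1).elim (fun h => hab (sub_eq_zero.mp h)) hg0

/-- Non-negative combinations of orthogonal projections are squares. -/
lemma exists_star_mul_self_eq_sum {S : Finset ℝ} {f : ℝ → B}
    (hf : ∀ r ∈ S, IsStarProjection (f r)) (horth : ∀ r ∈ S, ∀ s ∈ S, r ≠ s → f r * f s = 0)
    {φ : ℝ → ℝ} (hφ : ∀ r ∈ S, 0 ≤ φ r) :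
    ∃ z : B, star z * z = ∑ r ∈ S, (φ r : ℂ) • f r := by
  refine ⟨∑ r ∈ S, ((√(φ r) : ℝ) : ℂ) • f r, ?_⟩
  have hst : star (∑ r ∈ S, ((√(φ r) : ℝ) : ℂ) • f r) = ∑ r ∈ S, ((√(φ r) : ℝ) : ℂ) • f r := by
    rw [star_sum]
    refine Finset.sum_congr rfl fun r hr => ?_
    rw [star_smul, (hf r hr).isSelfAdjoint.star_eq, Complex.star_def, Complex.conj_ofReal]
  rw [hst, Finset.mul_sum]
  refine Finset.sum_congr rfl fun r hr => ?_
  rw [Finset.sum_mul, Finset.sum_eq_single_of_mem r hr, smul_mul_smul_comm,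
    (hf r hr).isIdempotentElem.eq, ← Complex.ofReal_mul, Real.mul_self_sqrt (hφ r hr)]
  intro s hs hsr
  rw [smul_mul_smul_comm, horth s hs r hr hsr, smul_zero]

/-- A selfadjoint element without negative eigenprojections is a square. -/
lemma exists_star_mul_self_eq [Algebra.IsIntegral ℂ B] (hp : IsProperInvolution B) {b : B}
    (hb : IsSelfAdjoint b)
    (h : ∀ (e : B) (r : ℝ), IsStarProjection e → e ≠ 0 → b * e = (r : ℂ) • e → 0 ≤ r) :
    ∃ z : B, star z * z = b := by
  obtain ⟨S, f, hf, horth, hsum⟩ := exists_spectral_decomposition hp hb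
  obtain ⟨z, hz⟩ := exists_star_mul_self_eq_sum (φ := id) (fun r hr => (hf r hr).1) horth
    fun r hr => h _ r (hf r hr).1 (hf r hr).2.1 (hf r hr).2.2
  refine ⟨z, hz.trans ?_⟩
  conv_rhs => rw [← mul_one b, ← hsum, Finset.mul_sum]
  exact Finset.sum_congr rfl fun r hr => (hf r hr).2.2.symm

/-- Sums of squares are squares. -/
theorem exists_star_mul_self_eq_add [Algebra.IsIntegral ℂ B] (hp : IsProperInvolution B) (x y : B) :
    ∃ z : B, star z * z = star x * x + star y * y := by
  refine exists_star_mul_self_eq hp ((IsSelfAdjoint.star_mul_self x).add (.star_mul_self y))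
    fun e r he he0 h => ?_
  by_contra! hr
  -- On some `g ≤ e`, `x* x` compresses to a scalar `t`, necessarily `≥ 0`; then `y* y` compresses
  -- to `r - t < 0`.
  obtain ⟨g, c, hg, hg0, heg, hge, hgx⟩ :=
    exists_projection_compression_scalar hp he he0 (star x * x)
  have hgs : star g = g := hg.isSelfAdjoint
  have hgg : g * g = g := hg.isIdempotentElem
  have hc : star c = c := by
    have h1 := congrArg star hgx
    rw [star_mul, star_mul, star_mul, star_star, hgs, star_smul, hgs, ← mul_assoc, hgx,
      ← sub_eq_zero, ← sub_smul] at h1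
    exact ((sub_eq_zero.mp ((smul_eq_zero.mp h1).resolve_right hg0))).symm
  obtain ⟨t, rfl⟩ := Complex.conj_eq_iff_real.mp hc
  have ht : 0 ≤ t := by
    by_contra! ht
    exact star_mul_self_ne_neg_smul hp hg hg0 x ht hgx
  have hgy : g * (star y * y) * g = ((r - t : ℝ) : ℂ) • g := by
    have h2 : g * (star x * x + star y * y) * g = (r : ℂ) • g := by
      rw [mul_assoc]
      nth_rewrite 2 [← heg]
      rw [← mul_assoc _ e g, h, smul_mul_assoc, heg, mul_smul_comm, hgg]
    rw [mul_add, add_mul, hgx] at h2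
    rw [Complex.ofReal_sub, sub_smul, ← h2, add_sub_cancel_left]
  exact star_mul_self_ne_neg_smul hp hg hg0 y (by linarith) hgy

end Unital

end AlgStar

namespace AlgStar

/-! ### The pre-C*-norm defined by the order -/

section Unital

variable {B : Type*} [Ring B] [Algebra ℂ B] [StarRing B]

/-- `b` is of the form `z* z`. -/
def IsStarSquare {B : Type*} [Mul B] [Star B] (b : B) : Prop :=
  ∃ z : B, star z * z = b

/-- `s ≥ 0` and `a* a ≤ s ^ 2` in the order given by the cone of squares. -/
def IsNormBound (a : B) (s : ℝ) : Prop :=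
  0 ≤ s ∧ IsStarSquare (((s ^ 2 : ℝ) : ℂ) • 1 - star a * a)

lemma isNormBound_zero : IsNormBound (0 : B) 0 :=
  ⟨le_rfl, 0, by simp⟩

/-- The least `s ≥ 0` with `a* a ≤ s ^ 2`. -/
noncomputable def cstarNorm (a : B) : ℝ :=
  sInf {s | IsNormBound a s}

lemma cstarNorm_le {a : B} {s : ℝ} (h : IsNormBound a s) : cstarNorm a ≤ s :=
  csInf_le ⟨0, fun _ ht => ht.1⟩ h

variable [StarModule ℂ B]

lemma IsStarSquare.add [Algebra.IsIntegral ℂ B] (hp : IsProperInvolution B) {b c : B}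
    (hb : IsStarSquare b) (hc : IsStarSquare c) : IsStarSquare (b + c) := by
  obtain ⟨x, rfl⟩ := hb
  obtain ⟨y, rfl⟩ := hc
  exact exists_star_mul_self_eq_add hp x y

lemma IsStarSquare.smul {b : B} (hb : IsStarSquare b) {t : ℝ} (ht : 0 ≤ t) :
    IsStarSquare ((t : ℂ) • b) := by
  obtain ⟨x, rfl⟩ := hb
  refine ⟨((√t : ℝ) : ℂ) • x, ?_⟩
  rw [star_smul, smul_mul_smul_comm, Complex.star_def, Complex.conj_ofReal, ← Complex.ofReal_mul,
    Real.mul_self_sqrt ht]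

lemma IsStarSquare.of_smul {b : B} {t : ℝ} (ht : 0 < t) (hb : IsStarSquare ((t : ℂ) • b)) :
    IsStarSquare b := by
  have := hb.smul (inv_nonneg.mpr ht.le)
  rwa [Complex.ofReal_inv, inv_smul_smul₀ (by exact_mod_cast ht.ne')] at this

lemma IsStarSquare.conj {R : Type*} [Semigroup R] [StarMul R] {b : R} (hb : IsStarSquare b) (x : R) :
    IsStarSquare (star x * b * x) := by
  obtain ⟨y, rfl⟩ := hb
  exact ⟨y * x, by rw [star_mul]; simp only [mul_assoc]⟩

lemma isStarSquare_smul_one {t : ℝ} (ht : 0 ≤ t) : IsStarSquare ((t : ℂ) • (1 : B)) :=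
  IsStarSquare.smul ⟨1, by simp⟩ ht

/-- The cone of squares is archimedean closed. -/
lemma isStarSquare_of_forall_pos [Algebra.IsIntegral ℂ B] (hp : IsProperInvolution B) {b : B}
    (hb : IsSelfAdjoint b) (h : ∀ t : ℝ, 0 < t → IsStarSquare (b + (t : ℂ) • 1)) :
    IsStarSquare b := by
  refine exists_star_mul_self_eq hp hb fun e r he he0 hbe => ?_
  by_contra! hr
  -- A shift by half of `|r|` leaves the compression negative.
  obtain ⟨z, hz⟩ := h (-r / 2) (by linarith)
  refine star_mul_self_ne_neg_smul hp he he0 z (r := r + -r / 2) (by linarith) ?_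
  rw [hz, mul_add, add_mul, mul_assoc, hbe, mul_smul_comm, mul_smul_comm, smul_mul_assoc, mul_one,
    he.isIdempotentElem.eq, ← add_smul, Complex.ofReal_add]

/-- On a spectral projection of `x* x` with value `r`, `y* y` compresses to `-r`; neither may be
negative, so `r = 0`. -/
lemma eq_zero_of_star_mul_self_add_eq_zero [Algebra.IsIntegral ℂ B] (hp : IsProperInvolution B)
    {x y : B} (h : star x * x + star y * y = 0) : x = 0 := by
  apply hp
  obtain ⟨S, f, hf, -, hsum⟩ := exists_spectral_decomposition hp (IsSelfAdjoint.star_mul_self x)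
  rw [← mul_one (star x * x), ← hsum, Finset.mul_sum]
  refine Finset.sum_eq_zero fun r hr => ?_
  obtain ⟨hp1, hne, hx⟩ := hf r hr
  have hx' : f r * (star x * x) * f r = (r : ℂ) • f r := by
    rw [mul_assoc, hx, mul_smul_comm, hp1.isIdempotentElem.eq]
  have hy' : f r * (star y * y) * f r = ((-r : ℝ) : ℂ) • f r := by
    rw [eq_neg_of_add_eq_zero_right h, mul_neg, neg_mul, hx', Complex.ofReal_neg, neg_smul]
  have h1 : ¬ r < 0 := fun hr => star_mul_self_ne_neg_smul hp hp1 hne x hr hx'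
  have h2 : ¬ -r < 0 := fun hr => star_mul_self_ne_neg_smul hp hp1 hne y hr hy'
  have : r = 0 := by linarith
  rw [hx, this, Complex.ofReal_zero, zero_smul]

lemma IsNormBound.mono [Algebra.IsIntegral ℂ B] (hp : IsProperInvolution B) {a : B} {s t : ℝ}
    (hs : IsNormBound a s) (hst : s ≤ t) : IsNormBound a t := by
  refine ⟨hs.1.trans hst, ?_⟩
  have h : 0 ≤ t ^ 2 - s ^ 2 := sub_nonneg.mpr (pow_le_pow_left₀ hs.1 hst 2)
  convert hs.2.add hp (isStarSquare_smul_one h) using 1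
  push_cast
  module

/-- `s² t² - b* a* a b = b* (s² - a* a) b + s² (t² - b* b)`. -/
lemma IsNormBound.mul [Algebra.IsIntegral ℂ B] (hp : IsProperInvolution B) {a b : B} {s t : ℝ}
    (ha : IsNormBound a s) (hb : IsNormBound b t) : IsNormBound (a * b) (s * t) := by
  refine ⟨mul_nonneg ha.1 hb.1, ?_⟩
  convert (ha.2.conj b).add hp (hb.2.smul (sq_nonneg s)) using 1
  rw [mul_sub, sub_mul, mul_smul_comm, mul_one, smul_mul_assoc, smul_sub, smul_smul,
    sub_add_sub_cancel', star_mul]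
  push_cast
  simp only [mul_assoc, mul_pow]

lemma IsNormBound.eq_zero [Algebra.IsIntegral ℂ B] (hp : IsProperInvolution B) {a : B}
    (ha : IsNormBound a 0) : a = 0 := by
  obtain ⟨-, z, hz⟩ := ha
  refine eq_zero_of_star_mul_self_add_eq_zero hp (y := z) ?_
  rw [hz]
  simp

/-- `s t ((s + t)² - (a + b)* (a + b))` equals `(s t + t²)(s² - a* a) + (s t + s²)(t² - b* b) + (t a
- s b)* (t a - s b)`. Dividing by `s t` requires treating zero bounds separately. -/
lemma IsNormBound.add [Algebra.IsIntegral ℂ B] (hp : IsProperInvolution B) {a b : B} {s t : ℝ}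
    (ha : IsNormBound a s) (hb : IsNormBound b t) : IsNormBound (a + b) (s + t) := by
  rcases ha.1.eq_or_lt with rfl | hs
  · rwa [ha.eq_zero hp, zero_add, zero_add]
  rcases hb.1.eq_or_lt with rfl | ht
  · rwa [hb.eq_zero hp, add_zero, add_zero]
  refine ⟨by positivity, .of_smul (mul_pos hs ht) ?_⟩
  have h1 := ha.2.smul (t := s * t + t ^ 2) (by positivity)
  have h2 := hb.2.smul (t := s * t + s ^ 2) (by positivity)
  have h3 : IsStarSquare (star ((t : ℂ) • a - (s : ℂ) • b) * ((t : ℂ) • a - (s : ℂ) • b)) :=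
    ⟨_, rfl⟩
  convert (h1.add hp h2).add hp h3 using 1
  simp only [star_sub, star_add, star_smul, Complex.star_def, Complex.conj_ofReal, sub_mul, mul_sub,
    add_mul, mul_add, smul_mul_assoc, mul_smul_comm]
  push_cast
  module

lemma IsNormBound.smul {a : B} {s : ℝ} (ha : IsNormBound a s) (c : ℂ) :
    IsNormBound (c • a) (‖c‖ * s) := by
  refine ⟨mul_nonneg (norm_nonneg c) ha.1, ?_⟩
  convert ha.2.smul (sq_nonneg ‖c‖) using 1
  rw [star_smul, smul_mul_smul_comm, smul_sub, smul_smul, ← Complex.ofReal_mul, mul_pow]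
  congr 2
  rw [Complex.star_def, ← Complex.normSq_eq_conj_mul_self, Complex.normSq_eq_norm_sq]

/-- With `h = a* a`, `2 s (s - h) = (s² - h²) + (s - h)²`. This supplies the C*-inequality `‖a‖² ≤
‖a* a‖`. -/
lemma IsNormBound.sqrt [Algebra.IsIntegral ℂ B] (hp : IsProperInvolution B) {a : B} {s : ℝ}
    (h : IsNormBound (star a * a) s) : IsNormBound a √s := by
  refine ⟨Real.sqrt_nonneg s, ?_⟩
  rw [Real.sq_sqrt h.1]
  rcases h.1.eq_or_lt with rfl | hs
  · exact ⟨0, by simp [h.eq_zero hp]⟩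
  refine .of_smul (t := 2 * s) (by linarith) ?_
  have h3 : IsStarSquare (star ((s : ℂ) • 1 - star a * a) * ((s : ℂ) • 1 - star a * a)) := ⟨_, rfl⟩
  convert h.2.add hp h3 using 1
  simp only [star_sub, star_smul, star_one, star_mul, star_star, Complex.star_def,
    Complex.conj_ofReal, sub_mul, mul_sub, smul_mul_assoc, mul_smul_comm, mul_one, one_mul]
  push_cast
  module

lemma exists_isNormBound [Algebra.IsIntegral ℂ B] (hp : IsProperInvolution B) (a : B) :
    ∃ s, IsNormBound a s := by
  have hb := IsSelfAdjoint.star_mul_self a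
  obtain ⟨S, f, hf, horth, hsum⟩ := exists_spectral_decomposition hp hb
  have h0 : 0 ≤ ∑ r ∈ S, |r| := Finset.sum_nonneg fun r _ => abs_nonneg r
  refine ⟨√(∑ r ∈ S, |r|), Real.sqrt_nonneg _, ?_⟩
  rw [Real.sq_sqrt h0]
  set t := ∑ r ∈ S, |r|
  obtain ⟨z, hz⟩ := exists_star_mul_self_eq_sum (φ := fun r => t - r)
    (fun r hr => (hf r hr).1) horth fun r hr => sub_nonneg.mpr
      ((le_abs_self r).trans (Finset.single_le_sum (f := fun r => |r|) (fun r _ => abs_nonneg r) hr))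
  refine ⟨z, hz.trans ?_⟩
  conv_rhs => rw [← mul_one (star a * a), ← hsum, Finset.mul_sum, Finset.smul_sum,
    ← Finset.sum_sub_distrib]
  refine Finset.sum_congr rfl fun r hr => ?_
  rw [(hf r hr).2.2, Complex.ofReal_sub, sub_smul]

/-- The infimum is attained because the cone is archimedean closed. -/
lemma isNormBound_cstarNorm [Algebra.IsIntegral ℂ B] (hp : IsProperInvolution B) (a : B) :
    IsNormBound a (cstarNorm a) := by
  have h0 : 0 ≤ cstarNorm a := le_csInf (exists_isNormBound hp a) fun _ ht => ht.1
  refine ⟨h0, isStarSquare_of_forall_pos hp ?_ fun t ht => ?_⟩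
  · refine IsSelfAdjoint.sub ?_ (.star_mul_self a)
    rw [IsSelfAdjoint, star_smul, star_one, Complex.star_def, Complex.conj_ofReal]
  · have hlt : cstarNorm a < √(cstarNorm a ^ 2 + t) := Real.lt_sqrt_of_sq_lt (by linarith)
    obtain ⟨s, hs, hst⟩ := exists_lt_of_csInf_lt (exists_isNormBound hp a) hlt
    have := (IsNormBound.mono hp hs hst.le).2
    rw [Real.sq_sqrt (by positivity)] at this
    convert this using 1
    push_cast
    module

/-- A unital integral *-algebra with proper involution has a pre-C*-norm. -/
theorem hasPreCStarNorm_of_isIntegral [Algebra.IsIntegral ℂ B] (hp : IsProperInvolution B) :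
    HasPreCStarNorm B := by
  have hb := isNormBound_cstarNorm hp
  have h0 : cstarNorm (0 : B) = 0 := le_antisymm (cstarNorm_le isNormBound_zero) (hb 0).1
  have hmul : ∀ a b : B, cstarNorm (a * b) ≤ cstarNorm a * cstarNorm b := fun a b =>
    cstarNorm_le ((hb a).mul hp (hb b))
  have hsq : ∀ a : B, cstarNorm a ^ 2 ≤ cstarNorm (star a * a) := fun a => by
    rw [← Real.le_sqrt (hb a).1 (hb _).1]
    exact cstarNorm_le ((hb _).sqrt hp)
  -- Cancel `‖a‖` in `‖a‖² ≤ ‖a* a‖ ≤ ‖a*‖ ‖a‖`.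
  have hle : ∀ a : B, cstarNorm a ≤ cstarNorm (star a) := fun a => by
    rcases (hb a).1.eq_or_lt with h | h
    · rw [← h]; exact (hb _).1
    · have := (hsq a).trans (hmul _ _)
      rw [sq] at this
      exact le_of_mul_le_mul_right this h
  refine ⟨Seminorm.ofSMulLE cstarNorm h0 (fun a b => cstarNorm_le ((hb a).add hp (hb b)))
    (fun c a => cstarNorm_le ((hb a).smul c)), hmul, fun a => le_antisymm ?_ (hsq a), fun a ha => ?_⟩
  · have h1 : cstarNorm (star a) ≤ cstarNorm a := by simpa using hle (star a)
    exact (hmul _ _).trans (by rw [sq]; exact mul_le_mul_of_nonneg_right h1 (hb a).1)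
  · have h2 : cstarNorm a = 0 := ha
    exact (h2 ▸ hb a).eq_zero hp

end Unital

end AlgStar

namespace AlgStar

/-! ### Unitization and spectrum -/

section NonUnital

lemma isProperInvolution_of_hasPreCStarNorm {R : Type*} [NonUnitalRing R] [Module ℂ R] [StarRing R]
    (h : HasPreCStarNorm R) : IsProperInvolution R := by
  obtain ⟨σ, -, hσ, hσ0⟩ := h
  intro a ha
  refine hσ0 a ?_
  have := hσ a
  rw [ha, map_zero] at this
  exact pow_eq_zero_iff two_ne_zero |>.mp this.symm

/-- The projection `e` belonging to `a*` satisfies `e a = a`, while `a* a = 0` gives `e a = 0`. -/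
lemma isProperInvolution_of_isWeaklyRickart {R : Type*} [NonUnitalRing R] [StarRing R]
    (h : IsWeaklyRickart R) : IsProperInvolution R := by
  intro a ha
  obtain ⟨e, he, hae, hey⟩ := h (star a)
  have h1 := congrArg star hae
  rw [star_mul, star_star, he.isSelfAdjoint.star_eq, hey a ha] at h1
  exact h1.symm

variable {A : Type*} [NonUnitalRing A] [Module ℂ A] [IsScalarTower ℂ A A] [SMulCommClass ℂ A A]

lemma isIntegral_unitization (hA : IsAlgebraicAlgebra A) :
    Algebra.IsIntegral ℂ (Unitization ℂ A) := by
  refine ⟨fun x => ?_⟩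
  set S := NonUnitalAlgebra.adjoin ℂ ({x.snd} : Set A) with hS
  have : FiniteDimensional ℂ S := hA x.snd
  have : Module.Finite ℂ (Unitization ℂ S) :=
    Module.Finite.equiv (Unitization.linearEquiv ℂ ℂ S).symm
  let φ : Unitization ℂ S →ₐ[ℂ] Unitization ℂ A :=
    Unitization.lift ((Unitization.inrNonUnitalAlgHom ℂ A).comp (NonUnitalSubalgebraClass.subtype S))
  have hx : x.snd ∈ S := NonUnitalAlgebra.subset_adjoin ℂ rfl
  have h := (IsIntegral.of_finite ℂ (Unitization.inl x.fst + Unitization.inr (⟨x.snd, hx⟩ : S) :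
    Unitization ℂ S)).map φ
  have h2 : φ (Unitization.inl x.fst + Unitization.inr (⟨x.snd, hx⟩ : S)) = x := by
    rw [map_add]
    ext <;> simp [φ, Unitization.algebraMap_eq_inl]
  rwa [h2] at h

/-- If `A` has a unit `u`, then `(t, b) ↦ t u + b` is a unital homomorphism onto `A` and carries
inverses to inverses. -/
lemma sp_subset_spectrum {a : A} : Sp a ⊆ spectrum ℂ (a : Unitization ℂ A) := by
  intro z hz
  by_cases hu : ∃ u : A, IsUnitElement u
  · obtain ⟨u, hu⟩ := hu
    rw [spectrum.mem_iff]
    rintro ⟨⟨w, v, hwv, hvw⟩, rfl : w = _⟩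
    refine hz.1 u hu ⟨v.fst • u + v.snd, ?_, ?_⟩
    · have := congrArg (fun t : Unitization ℂ A => t.fst • u + t.snd) hwv
      simp [sub_eq_add_neg, mul_add, add_mul, (hu _).1, (hu _).2, mul_smul_comm, smul_mul_assoc,
        Unitization.algebraMap_eq_inl] at this ⊢
      refine Eq.trans ?_ this
      module
    · have := congrArg (fun t : Unitization ℂ A => t.fst • u + t.snd) hvw
      simp [sub_eq_add_neg, mul_add, add_mul, (hu _).1, (hu _).2, mul_smul_comm, smul_mul_assoc,
        Unitization.algebraMap_eq_inl] at this ⊢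
      refine Eq.trans ?_ this
      module
  · exact hz.2 hu

lemma isUnit_of_notMem_sp [Algebra.IsIntegral ℂ (Unitization ℂ A)] {a : A} {z : ℂ} (hz0 : z ≠ 0)
    (hz : z ∉ Sp a) : IsUnit (algebraMap ℂ (Unitization ℂ A) z - a) := by
  by_cases hu : ∃ u : A, IsUnitElement u
  · have h : ∃ u : A, IsUnitElement u ∧ ∃ x : A, (z • u - a) * x = u ∧ x * (z • u - a) = u := by
      by_contra! hcon
      exact hz ⟨fun u hu ⟨x, hx1, hx2⟩ => hcon u hu x hx1 hx2, fun h => absurd hu h⟩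
    obtain ⟨u, hu, x, -, hx⟩ := h
    -- The left inverse is `x + z⁻¹ (1 - u)`: `x` on `A`, and `z⁻¹` on the complementary summand,
    -- where `z ≠ 0` is needed.
    refine isUnit_of_mul_eq_one_of_isIntegral
      (c := (Unitization.inl z⁻¹ + Unitization.inr (x - z⁻¹ • u) : Unitization ℂ A)) ?_
    rw [mul_sub, mul_smul_comm, (hu x).2] at hx
    rw [Unitization.algebraMap_eq_inl]
    ext
    · simp [sub_eq_add_neg, hz0]
    · have h1 := congrArg (· - u) hx
      simp only [sub_self] at h1
      simp [sub_eq_add_neg, add_mul, mul_add, (hu a).1, smul_smul, hz0] at h1 ⊢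
      rw [← h1]
      abel
  · by_contra h
    exact hz ⟨fun u h' => absurd ⟨u, h'⟩ hu, fun _ => h⟩

/-! ### The Jacobson radical -/

/-- Elements `a` such that every `c a` is left quasi-invertible lie in the Jacobson radical. -/
lemma mem_jacobsonRadical {a : A} (h : ∀ c : A, ∃ w : A, w + c * a - w * (c * a) = 0) :
    a ∈ jacobsonRadical A := by
  rw [jacobsonRadical, Submodule.mem_sInf]
  intro L hL
  by_contra haL
  obtain ⟨u, hu⟩ := hL.modular
  have htop : ∀ M : Submodule ℂ A, IsLeftIdeal M → L ≤ M → M ≠ L → M = ⊤ := fun M hM hLM hne =>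
    hL.eq_top_of_lt M hM (lt_of_le_of_ne hLM hne.symm)
  -- Otherwise `{y | A y ⊆ L}` contains both `L` and `a`, hence is everything; then `x u ∈ L` for
  -- all `x`, and modularity gives `L = A`.
  have hAa : ∃ c, c * a ∉ L := by
    by_contra! hcon
    let M : Submodule ℂ A :=
      { carrier := {y | ∀ x, x * y ∈ L}
        add_mem' := fun hx hy z => by rw [mul_add]; exact L.add_mem (hx z) (hy z)
        zero_mem' := fun x => by rw [mul_zero]; exact L.zero_mem
        smul_mem' := fun c x hx z => by rw [mul_smul_comm]; exact L.smul_mem c (hx z) }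
    have hM : M = ⊤ := htop M (fun x y hy z => by rw [← mul_assoc]; exact hy _)
      (fun y hy x => hL.isLeftIdeal x y hy) fun h => haL (h ▸ show a ∈ M from hcon)
    apply hL.ne_top
    rw [eq_top_iff]
    intro x _
    have h1 : u ∈ M := hM ▸ Submodule.mem_top
    simpa using L.add_mem (hu x) (h1 x)
  obtain ⟨c₀, hc₀⟩ := hAa
  let N : Submodule ℂ A := L ⊔ LinearMap.range (LinearMap.mulRight ℂ a)
  have hN : N = ⊤ := by
    refine htop N (fun x y hy => ?_) le_sup_left fun h => hc₀ ?_
    · obtain ⟨l, hl, _, ⟨c, rfl⟩, rfl⟩ := Submodule.mem_sup.mp hy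
      refine Submodule.mem_sup.mpr ⟨x * l, hL.isLeftIdeal x l hl, _, ⟨x * c, rfl⟩, ?_⟩
      simp [mul_add, mul_assoc]
    · rw [← h]
      exact Submodule.mem_sup_right ⟨c₀, rfl⟩
  obtain ⟨l, hl, _, ⟨c, rfl⟩, hlc⟩ := Submodule.mem_sup.mp (hN ▸ Submodule.mem_top : u ∈ N)
  obtain ⟨w, hw⟩ := h c
  -- From `u = l + c a`, the element `c a` is also a modular unit for `L`; its left quasi-inverse
  -- `w` then puts every `x` in `L`.
  have h1 : ∀ x, x - x * (c * a) ∈ L := by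
    intro x
    have := L.add_mem (hu x) (hL.isLeftIdeal x l hl)
    rw [← hlc] at this
    rwa [LinearMap.mulRight_apply, mul_add, ← sub_sub, sub_right_comm, sub_add_cancel] at this
  apply hL.ne_top
  rw [eq_top_iff]
  intro x _
  have h2 := h1 (x - x * w)
  have h3 : x * w + x * (c * a) - x * w * (c * a) = 0 := by
    rw [mul_assoc x w, ← mul_add, ← mul_sub, hw, mul_zero]
  have h4 : x - x * w - (x - x * w) * (c * a) = x := by
    rw [sub_mul, sub_sub, sub_eq_self, ← h3]
    abel
  rwa [h4] at h2

/-- A non-zero idempotent avoids some maximal modular left ideal. -/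
lemma exists_isMaximalModularLeftIdeal_notMem {e : A} (he : e * e = e) (he0 : e ≠ 0) :
    ∃ L : Submodule ℂ A, IsMaximalModularLeftIdeal L ∧ e ∉ L := by
  -- Every `x - x e` lies in this kernel, so a left ideal containing the kernel is proper exactly
  -- when it avoids `e`.
  have hzorn : ∃ L, LinearMap.ker (LinearMap.mulRight ℂ e) ≤ L ∧
      Maximal (· ∈ {M : Submodule ℂ A | IsLeftIdeal M ∧ e ∉ M}) L := by
    refine zorn_le_nonempty₀ _ ?_ _ ⟨fun x y hy => ?_, fun h => ?_⟩
    · intro C hC hchain M hM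
      refine ⟨sSup C, ⟨fun x y hy => ?_, fun h => ?_⟩, fun N hN => le_sSup hN⟩
      · rw [Submodule.mem_sSup_of_directed ⟨M, hM⟩ hchain.directedOn] at hy ⊢
        obtain ⟨N, hN, hy⟩ := hy
        exact ⟨N, hN, (hC hN).1 x y hy⟩
      · rw [Submodule.mem_sSup_of_directed ⟨M, hM⟩ hchain.directedOn] at h
        obtain ⟨N, hN, h⟩ := h
        exact (hC hN).2 h
    · simp only [LinearMap.mem_ker, LinearMap.mulRight_apply] at hy ⊢
      rw [mul_assoc, hy, mul_zero]
    · simp only [LinearMap.mem_ker, LinearMap.mulRight_apply, he] at h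
      exact he0 h
  obtain ⟨L, hL0, hL⟩ := hzorn
  refine ⟨L, ⟨hL.prop.1, ⟨e, fun x => hL0 ?_⟩, fun h => ?_, fun M hM hLM => ?_⟩, hL.prop.2⟩
  · simp [sub_mul, mul_assoc, he]
  · exact hL.prop.2 (h ▸ Submodule.mem_top)
  · by_contra hM1
    have heM : e ∉ M := by
      intro heM
      apply hM1
      rw [eq_top_iff]
      intro x _
      have h1 : x - x * e ∈ M := hLM.le (hL0 (by simp [sub_mul, mul_assoc, he]))
      simpa using M.add_mem h1 (hM x e heM)
    exact hLM.not_ge (hL.le_of_ge ⟨hM, heM⟩ hLM.le)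

lemma isJacobsonSemisimple_of_isVonNeumannRegular (h : IsVonNeumannRegular A) :
    IsJacobsonSemisimple A := by
  rw [IsJacobsonSemisimple, eq_bot_iff]
  intro a ha
  rw [Submodule.mem_bot]
  obtain ⟨x, hx⟩ := h a
  by_contra ha0
  have he : x * a * (x * a) = x * a := by rw [mul_assoc x, ← mul_assoc a, hx]
  obtain ⟨L, hL, hxL⟩ := exists_isMaximalModularLeftIdeal_notMem (e := x * a) he fun h0 =>
    ha0 (by rw [← hx, mul_assoc, h0, mul_zero])
  exact hxL (hL.isLeftIdeal x a (Submodule.mem_sInf.mp ha L hL))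

/-! ### Properness and spectral decompositions without a unit -/

variable [StarRing A]

/-- Let `f` be a spectral projection of `k` with value `c ≠ 0`, so `h² f = -c² f`. A spectral
projection `e` of `h` with value `d` satisfies `(d² + c²) e f = 0`; hence `h f = 0`, contradicting
`c² f ≠ 0`. -/
lemma eq_zero_of_mul_self_add_mul_self_eq_zero (h4 : HasFiniteSpectralDecompositions A) {h k : A}
    (hh : IsSelfAdjoint h) (hk : IsSelfAdjoint k) (hhk : h * h + k * k = 0) : k = 0 := by
  by_contra hk0
  obtain ⟨n, c, f, hc, -, hf, hforth, hksum⟩ := h4 k hk hk0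
  have hn : ∃ i : Fin n, True := by
    by_contra! hn
    apply hk0
    rw [hksum]
    exact Finset.sum_eq_zero fun i _ => (hn i).elim
  obtain ⟨i, -⟩ := hn
  have hkf : k * f i = (c i : ℂ) • f i := by
    rw [hksum, Finset.sum_mul, Finset.sum_eq_single_of_mem i (Finset.mem_univ i),
      smul_mul_assoc, (hf i).1.isIdempotentElem.eq]
    intro j _ hj
    rw [smul_mul_assoc, hforth j i hj, smul_zero]
  have hhf : h * h * f i = ((-(c i) ^ 2 : ℝ) : ℂ) • f i := by
    rw [eq_neg_of_add_eq_zero_left hhk, neg_mul, mul_assoc, hkf, mul_smul_comm, hkf, smul_smul,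
      ← neg_smul]
    push_cast
    rw [sq]
  have hhf0 : h * f i = 0 := by
    by_cases hh0 : h = 0
    · rw [hh0, zero_mul]
    obtain ⟨m, d, e, hd, -, he, heorth, hhsum⟩ := h4 h hh hh0
    conv_lhs => rw [hhsum, Finset.sum_mul]
    refine Finset.sum_eq_zero fun j _ => ?_
    have heh : e j * h = (d j : ℂ) • e j := by
      rw [hhsum, Finset.mul_sum, Finset.sum_eq_single_of_mem j (Finset.mem_univ j),
        mul_smul_comm, (he j).1.isIdempotentElem.eq]
      intro l _ hl
      rw [mul_smul_comm, heorth j l hl.symm, smul_zero]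
    have h1 : ((d j * d j + (c i) ^ 2 : ℝ) : ℂ) • (e j * f i) = 0 := by
      have h2 : e j * (h * h * f i) = ((d j : ℂ) * d j) • (e j * f i) := by
        rw [← mul_assoc, ← mul_assoc, heh, smul_mul_assoc, heh, smul_smul, smul_mul_assoc]
      rw [hhf, mul_smul_comm] at h2
      push_cast at h2 ⊢
      rw [add_smul, ← h2, ← add_smul, neg_add_cancel, zero_smul]
    have h3 : (d j * d j + (c i) ^ 2 : ℝ) ≠ 0 := by
      have := sq_pos_of_ne_zero (hc i)
      have := mul_self_nonneg (d j)
      positivity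
    rw [smul_mul_assoc, (smul_eq_zero.mp h1).resolve_left (by exact_mod_cast h3), smul_zero]
  rw [mul_assoc, hhf0, mul_zero] at hhf
  rcases smul_eq_zero.mp hhf.symm with h | h
  · have : -(c i) ^ 2 = 0 := by exact_mod_cast h
    exact hc i (by simpa using this)
  · exact (hf i).2 h

variable [StarModule ℂ A]

/-- The scalar part of `x* x` is `|x.fst|²`, so `x* x = 0` forces `x` into `A`. -/
lemma isProperInvolution_unitization (hp : IsProperInvolution A) :
    IsProperInvolution (Unitization ℂ A) := by
  intro x hx
  have h1 : x.fst = 0 := by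
    have := congrArg (fun t : Unitization ℂ A => t.fst) hx
    simpa using this
  have h2 : x = (x.snd : Unitization ℂ A) := by
    ext <;> simp [h1]
  rw [h2, ← Unitization.inr_star, ← Unitization.inr_mul] at hx
  rw [h2, hp x.snd (Unitization.inr_injective hx), Unitization.inr_zero]

lemma hasPreCStarNorm_of_unitization (h : HasPreCStarNorm (Unitization ℂ A)) :
    HasPreCStarNorm A := by
  obtain ⟨σ, hσ1, hσ2, hσ3⟩ := h
  refine ⟨σ.comp (Unitization.inrHom ℂ ℂ A), fun a b => ?_, fun a => ?_, fun a ha => ?_⟩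
  · simpa using hσ1 (a : Unitization ℂ A) b
  · simpa using hσ2 (a : Unitization ℂ A)
  · exact Unitization.inr_injective (hσ3 (a : Unitization ℂ A) (by simpa using ha))

/-- Spectral decomposition in a nonunital algebraic *-algebra with proper involution. -/
theorem exists_spectral_sum (hA : IsAlgebraicAlgebra A) (hp : IsProperInvolution A) {b : A}
    (hb : IsSelfAdjoint b) :
    ∃ (S : Finset ℝ) (e : ℝ → A),
      (∀ r ∈ S, r ≠ 0 ∧ IsStarProjection (e r) ∧ e r ≠ 0) ∧
      (∀ r ∈ S, ∀ s ∈ S, r ≠ s → e r * e s = 0) ∧ b = ∑ r ∈ S, (r : ℂ) • e r := by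
  have := isIntegral_unitization hA
  have hb' : IsSelfAdjoint (b : Unitization ℂ A) := by
    rw [IsSelfAdjoint, ← Unitization.inr_star, hb.star_eq]
  obtain ⟨S, f, hf, horth, hsum⟩ :=
    exists_spectral_decomposition (isProperInvolution_unitization hp) hb'
  -- Scalar parts in `b f = r f` give `r · (f r).fst = 0`, so only the projection for `r = 0` can
  -- leave `A`.
  have hsnd : ∀ r ∈ S, r ≠ 0 → ((f r).snd : Unitization ℂ A) = f r := by
    intro r hr hr0
    have h1 := congrArg (fun t : Unitization ℂ A => t.fst) (hf r hr).2.2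
    have h2 : (f r).fst = 0 := by simpa [hr0] using h1
    ext <;> simp [h2]
  refine ⟨S.filter (· ≠ 0), fun r => (f r).snd, fun r hr => ?_, fun r hr s hs hrs => ?_, ?_⟩
  · obtain ⟨hr, hr0⟩ := Finset.mem_filter.mp hr
    obtain ⟨⟨h1, h2⟩, h3, -⟩ := hf r hr
    rw [← hsnd r hr hr0] at h1 h2 h3
    refine ⟨hr0, ⟨?_, ?_⟩, ?_⟩
    · exact Unitization.inr_injective (R := ℂ) ((Unitization.inr_mul ℂ _ _).trans h1)
    · exact Unitization.inr_injective (R := ℂ) ((Unitization.inr_star _).trans h2)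
    · intro (h : (f r).snd = 0); exact h3 (by rw [h, Unitization.inr_zero])
  · obtain ⟨hr, hr0⟩ := Finset.mem_filter.mp hr
    obtain ⟨hs, hs0⟩ := Finset.mem_filter.mp hs
    apply Unitization.inr_injective (R := ℂ)
    rw [Unitization.inr_mul, hsnd r hr hr0, hsnd s hs hs0, horth r hr s hs hrs,
      Unitization.inr_zero]
  · have h1 : (b : Unitization ℂ A) = ∑ r ∈ S, (r : ℂ) • f r := by
      conv_lhs => rw [← mul_one (b : Unitization ℂ A), ← hsum, Finset.mul_sum]
      exact Finset.sum_congr rfl fun r hr => (hf r hr).2.2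
    have h2 := congrArg (Unitization.sndHom ℂ ℂ A) h1
    rw [map_sum] at h2
    rw [Finset.sum_filter_of_ne]
    · simpa using h2
    · rintro r - h rfl
      simp at h

lemma hasFiniteSpectralDecompositions_of_isProperInvolution (hA : IsAlgebraicAlgebra A)
    (hp : IsProperInvolution A) : HasFiniteSpectralDecompositions A := by
  intro b hb _
  obtain ⟨S, e, he, horth, hsum⟩ := exists_spectral_sum hA hp hb
  refine ⟨S.card, fun j => (S.equivFin.symm j : ℝ), fun j => e (S.equivFin.symm j),
    fun j => (he _ (S.equivFin.symm j).2).1,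
    Subtype.val_injective.comp S.equivFin.symm.injective,
    fun j => (he _ (S.equivFin.symm j).2).2,
    fun i j hij => horth _ (S.equivFin.symm i).2 _ (S.equivFin.symm j).2 ?_, ?_⟩
  · exact fun h => hij (S.equivFin.symm.injective (Subtype.ext h))
  · rw [S.equivFin.symm.sum_comp (fun r : S => ((r : ℝ) : ℂ) • e r),
      Finset.sum_coe_sort S (fun r => (r : ℂ) • e r)]
    exact hsum

lemma isProperInvolution_of_hasFiniteSpectralDecompositions
    (h4 : HasFiniteSpectralDecompositions A) : IsProperInvolution A := by
  intro a ha
  have h1 : a * star a = 0 := by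
    refine eq_zero_of_mul_self_add_mul_self_eq_zero h4 (.zero A) (.mul_star_self a) ?_
    rw [zero_mul, zero_add, mul_assoc, ← mul_assoc (star a), ha, zero_mul, mul_zero]
  have hh : IsSelfAdjoint (a + star a) := .add_star_self a
  have hk : IsSelfAdjoint (Complex.I • (a - star a)) := by
    rw [IsSelfAdjoint, star_smul, star_sub, star_star, Complex.star_def, Complex.conj_I, neg_smul,
      ← smul_neg, neg_sub]
  -- The left side is `2 (a a* + a* a)`.
  have hsum : (a + star a) * (a + star a) +
      (Complex.I • (a - star a)) * (Complex.I • (a - star a)) = 0 := by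
    rw [smul_mul_smul_comm, Complex.I_mul_I]
    simp only [add_mul, mul_add, sub_mul, mul_sub, ha, h1]
    module
  have h2 := eq_zero_of_mul_self_add_mul_self_eq_zero h4 hh hk hsum
  have h3 := eq_zero_of_mul_self_add_mul_self_eq_zero h4 hk hh (by rw [add_comm, hsum])
  have h4 := (smul_eq_zero.mp h2).resolve_left Complex.I_ne_zero
  have h5 : (2 : ℂ) • a = (a + star a) + (a - star a) := by module
  rw [h3, h4, add_zero] at h5
  exact (smul_eq_zero.mp h5).resolve_left two_ne_zero

/-! ### Support projections, hermiticity and semisimplicity -/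

/-- The support projection of `a`, with a left inverse of `a` relative to it. -/
lemma exists_support_projection (hA : IsAlgebraicAlgebra A) (hp : IsProperInvolution A) (a : A) :
    ∃ e x : A, IsStarProjection e ∧ a * e = a ∧ x * a = e := by
  obtain ⟨S, f, hf, horth, hsum⟩ := exists_spectral_sum hA hp (IsSelfAdjoint.star_mul_self a)
  have hfa : ∀ r ∈ S, f r * (star a * a) = (r : ℂ) • f r := by
    intro r hr
    rw [hsum, Finset.mul_sum, Finset.sum_eq_single_of_mem r hr, mul_smul_comm,
      (hf r hr).2.1.isIdempotentElem.eq]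
    intro s hs hsr
    rw [mul_smul_comm, horth r hr s hs hsr.symm, smul_zero]
  set e := ∑ r ∈ S, f r with he
  have hes : star e = e := by
    rw [he, star_sum]
    exact Finset.sum_congr rfl fun r hr => (hf r hr).2.1.isSelfAdjoint
  have hee : ∀ r ∈ S, f r * e = f r := by
    intro r hr
    rw [he, Finset.mul_sum, Finset.sum_eq_single_of_mem r hr, (hf r hr).2.1.isIdempotentElem.eq]
    exact fun s hs hsr => horth r hr s hs hsr.symm
  have hae : star a * a * e = star a * a := by
    rw [hsum, Finset.sum_mul]
    exact Finset.sum_congr rfl fun r hr => by rw [smul_mul_assoc, hee r hr]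
  -- The left factor is the pseudo-inverse of `a* a` times `a*`; `a e = a` follows from `(a - a e)*
  -- (a - a e) = 0`.
  refine ⟨e, ∑ r ∈ S, (r : ℂ)⁻¹ • (f r * star a), ⟨?_, hes⟩, ?_, ?_⟩
  · show e * e = e
    conv_lhs => rw [he, Finset.sum_mul]
    exact Finset.sum_congr rfl hee
  · rw [← sub_eq_zero]
    apply hp
    rw [star_sub, star_mul, hes, sub_mul, mul_sub, mul_sub, mul_assoc e, ← mul_assoc (star a) a e,
      mul_assoc e (star a) a, hae, sub_self, sub_self, sub_self]
  · rw [Finset.sum_mul, he]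
    refine Finset.sum_congr rfl fun r hr => ?_
    rw [smul_mul_assoc, mul_assoc, hfa r hr,
      inv_smul_smul₀ (by exact_mod_cast (hf r hr).1)]

lemma isHermitianAlgebra_of_isProperInvolution (hA : IsAlgebraicAlgebra A)
    (hp : IsProperInvolution A) : IsHermitianAlgebra A := by
  have := isIntegral_unitization hA
  intro a ha z hz
  have hz' := sp_subset_spectrum hz
  rw [spectrum.mem_iff] at hz'
  obtain ⟨x, hx, -, h⟩ := (isUnit_or_exists_ne_zero _).resolve_left hz'
  have ha' : IsSelfAdjoint (a : Unitization ℂ A) := by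
    rw [IsSelfAdjoint, ← Unitization.inr_star, ha.star_eq]
  refine eigenvalue_im_eq_zero (isProperInvolution_unitization hp) ha' hx ?_
  rw [sub_mul, sub_eq_zero, ← Algebra.smul_def] at h
  exact h.symm

/-- In a hermitian algebra `1 + s` is invertible for skew-adjoint `s`. -/
lemma isUnit_one_add_of_star_eq_neg [Algebra.IsIntegral ℂ (Unitization ℂ A)]
    (hh : IsHermitianAlgebra A) {s : A} (hs : star s = -s) :
    IsUnit (1 + (s : Unitization ℂ A)) := by
  have hsa : IsSelfAdjoint (Complex.I • s) := by
    rw [IsSelfAdjoint, star_smul, hs, Complex.star_def, Complex.conj_I, neg_smul_neg]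
  have hz : -Complex.I ∉ Sp (Complex.I • s) := fun h => by
    have := hh _ hsa _ h
    simp at this
  have hu := isUnit_of_notMem_sp (by simp) hz
  have h1 : (1 + (s : Unitization ℂ A)) = algebraMap ℂ (Unitization ℂ A) Complex.I *
      (algebraMap ℂ (Unitization ℂ A) (-Complex.I) - ((Complex.I • s : A) :)) := by
    rw [mul_sub, ← map_mul, Unitization.inr_smul, ← Algebra.smul_def, smul_smul]
    simp
  rw [h1]
  exact (((isUnit_iff_ne_zero.mpr Complex.I_ne_zero)).map _).mul hu

lemma isProperInvolution_of_isJacobsonSemisimple (hA : IsAlgebraicAlgebra A)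
    (hh : IsHermitianAlgebra A) (hs : IsJacobsonSemisimple A) : IsProperInvolution A := by
  have := isIntegral_unitization hA
  intro a ha
  rw [← Submodule.mem_bot ℂ, ← show jacobsonRadical A = ⊥ from hs]
  refine mem_jacobsonRadical fun c => ?_
  set y := a * c with hy
  have hyy : star y * y = 0 := by
    rw [hy, star_mul, mul_assoc, ← mul_assoc (star a), ha, zero_mul, mul_zero]
  obtain ⟨v, hv⟩ := (isUnit_one_add_of_star_eq_neg hh (s := star y - y)
    (by rw [star_sub, star_star, neg_sub])).exists_left_inv
  -- As `y* y = 0`, this product is `1` plus a skew-adjoint element, hence invertible; so `1 - y`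
  -- has a left inverse and, by integrality, is a unit.
  have h1 : (1 + (star y : A)) * (1 - (y : Unitization ℂ A)) = 1 + ((star y - y : A) :) := by
    rw [mul_sub, mul_one, add_mul, one_mul, ← Unitization.inr_mul, hyy, Unitization.inr_zero,
      Unitization.inr_sub]
    abel
  rw [← h1, ← mul_assoc] at hv
  obtain ⟨w, hw⟩ := (isUnit_of_mul_eq_one_of_isIntegral hv).exists_left_inv
  -- A left inverse `w` of `1 - a c` yields the left inverse `1 + c w a` of `1 - c a`; its
  -- `A`-component, negated, is the quasi-inverse.
  have h2 : (1 + (c : Unitization ℂ A) * w * a) * (1 - (c : Unitization ℂ A) * a) = 1 := by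
    have h3 : (c : Unitization ℂ A) * w * a * (1 - (c : Unitization ℂ A) * a) =
        c * (w * (1 - (y : Unitization ℂ A))) * a := by
      rw [hy, Unitization.inr_mul]
      noncomm_ring
    rw [add_mul, h3, hw]
    noncomm_ring
  set t := (c : Unitization ℂ A) * w * a with ht
  have htf : t.fst = 0 := by simp [ht]
  refine ⟨-t.snd, ?_⟩
  have h3 := congrArg (fun t : Unitization ℂ A => t.snd) h2
  simp [sub_eq_add_neg, add_mul, mul_add, htf] at h3
  rw [← neg_zero, ← h3]
  noncomm_ring

lemma isWeaklyRickart_of_isProperInvolution (hA : IsAlgebraicAlgebra A)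
    (hp : IsProperInvolution A) : IsWeaklyRickart A := by
  intro a
  obtain ⟨e, x, he, hae, hxa⟩ := exists_support_projection hA hp a
  exact ⟨e, he, hae, fun y hy => by rw [← hxa, mul_assoc, hy, mul_zero]⟩

lemma isVonNeumannRegular_of_isProperInvolution (hA : IsAlgebraicAlgebra A)
    (hp : IsProperInvolution A) : IsVonNeumannRegular A := by
  intro a
  obtain ⟨e, x, -, hae, hxa⟩ := exists_support_projection hA hp a
  exact ⟨x, by rw [mul_assoc, hxa, hae]⟩

end NonUnital

end AlgStar

theorem theorem2p3 (A : Type*) [NonUnitalRing A] [Module ℂ A] [IsScalarTower ℂ A A]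
    [SMulCommClass ℂ A A] [StarRing A] [StarModule ℂ A]
    (hA : AlgStar.IsAlgebraicAlgebra A) :
    List.TFAE
      [AlgStar.HasPreCStarNorm A,
        AlgStar.IsProperInvolution A,
        AlgStar.IsHermitianAlgebra A ∧ AlgStar.IsJacobsonSemisimple A,
        AlgStar.HasFiniteSpectralDecompositions A,
        AlgStar.IsWeaklyRickart A,
        AlgStar.IsHermitianAlgebra A ∧ AlgStar.IsVonNeumannRegular A] := by
  tfae_have 1 → 2 := AlgStar.isProperInvolution_of_hasPreCStarNorm
  tfae_have 2 → 1 := fun hp => by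
    have := AlgStar.isIntegral_unitization hA
    exact AlgStar.hasPreCStarNorm_of_unitization
      (AlgStar.hasPreCStarNorm_of_isIntegral (AlgStar.isProperInvolution_unitization hp))
  tfae_have 2 → 4 := AlgStar.hasFiniteSpectralDecompositions_of_isProperInvolution hA
  tfae_have 4 → 2 := AlgStar.isProperInvolution_of_hasFiniteSpectralDecompositions
  tfae_have 2 → 5 := AlgStar.isWeaklyRickart_of_isProperInvolution hA
  tfae_have 5 → 2 := AlgStar.isProperInvolution_of_isWeaklyRickart
  tfae_have 2 → 6 := fun hp => ⟨AlgStar.isHermitianAlgebra_of_isProperInvolution hA hp,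
    AlgStar.isVonNeumannRegular_of_isProperInvolution hA hp⟩
  tfae_have 6 → 3 := fun h => ⟨h.1, AlgStar.isJacobsonSemisimple_of_isVonNeumannRegular h.2⟩
  tfae_have 3 → 2 := fun h => AlgStar.isProperInvolution_of_isJacobsonSemisimple hA h.1 h.2
  tfae_finish
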